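/- On $L^2(\mathbb{R})=L^2(\mathbb{R};\mathbb{C})$ let $\mathcal{F}$ be the unitary Fourier transform, $(\mathcal{F}\psi)(k)=(2\pi)^{-1/2}\int_{\mathbb{R}}e^{-ikx}\psi(x)\,dx$ for $\psi\in L^1(\mathbb{R})\cap L^2(\mathbb{R})$, let $I$ be the unitary involution $(I\psi)(x)=\frac1x\psi\left(\frac1x\right)$, and for $\lambda>0$ let $S_\lambda$ be the translation $(S_\lambda\psi)(x)=\psi\left(x-\frac1\lambda\right)$. Let $B:=\mathcal{F}^*I\mathcal{F}$ and $B_\lambda:=S_\lambda^*B$, which are unitary operators on $L^2(\mathbb{R})$. Let $J_0(t)=\sum_{k\ge0}\frac{(-1)^k}{(k!)^2}\left(\frac t2\right)^{2k}$ be the Bessel function of the first kind of order $0$, let $\operatorname{sgn}(x)=x/|x|$ for $x\neq0$ and $\operatorname{sgn}(0)=0$, and put $$\mathbb{B}(x,y)\;=\;i\,\frac{\operatorname{sgn}(x)-\operatorname{sgn}(y)}{2}\,J_0\left(2\sqrt{|xy|}\right),\qquad x,y\in\mathbb{R}.$$ **(1)** The subspace $L^2(\mathbb{R})\cap L^1(\mathbb{R})$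 is dense in $L^2(\mathbb{R})$, and for every $\psi$ in it and every $\lambda>0$, $$(B\psi)(x)=\int_{\mathbb{R}}\mathbb{B}(x,y)\,\psi(y)\,dy,\qquad (B_\lambda\psi)(x)=\int_{\mathbb{R}}\mathbb{B}\left(x+\tfrac1\lambda,y\right)\psi(y)\,dy$$ for almost every $x\in\mathbb{R}$, where the integrals converge absolutely for every $x\in\mathbb{R}$. **(2)** For all $(x,y)\in\mathbb{R}^2$, $$\mathcal{P}\!\!\int_{\mathbb{R}}\frac{e^{ixu}e^{-iy/u}}{u}\,du\;=\;2\pi i\,\frac{\operatorname{sgn}(x)-\operatorname{sgn}(y)}{2}\,J_0\left(2\sqrt{|xy|}\right),$$ where $\mathcal{P}\!\int_{\mathbb{R}}f(u)\,du:=\lim_{R\to+\infty,\;r\to0^+}\int_{[-R,-r]\cup[r,R]}f(u)\,du$, the limit being taken jointly and independently in $R$ and $r$. **(3)** For all $x,y\in\mathbb{R}$ and all $0<r<R$, $$\left|\int_{[-R,-r]\cup[r,R]}\frac{e^{ixu}e^{-iy/u}}{u}\,du\right|\;\le\;4\pi.$$ -/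

import Mathlib

open MeasureTheory Filter Topology
open scoped ENNReal

namespace LuttingerB

/-- The Hilbert space `L²(ℝ)` of complex-valued functions. -/
abbrev L2 : Type := Lp ℂ 2 (volume : Measure ℝ)

/-! ### Weighted composition operators `(T ψ)(x) = w(x) ψ(φ(x))` on `L²(ℝ)` -/

/-- The data of an isometric weighted composition operator: `∫ |w|² (g ∘ φ) = ∫ g` for all
nonnegative measurable `g`. -/
structure IsIsoWeight (w : ℝ → ℂ) (φ : ℝ → ℝ) : Prop where
  measurable_w : Measurable w
  measurable_φ : Measurable φ
  ne_zero : ∀ᵐ x : ℝ, w x ≠ 0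
  lintegral_eq : ∀ g : ℝ → ℝ≥0∞, Measurable g → ∫⁻ x, ‖w x‖ₑ ^ 2 * g (φ x) = ∫⁻ x, g x

theorem IsIsoWeight.quasi {w : ℝ → ℂ} {φ : ℝ → ℝ} (h : IsIsoWeight w φ) :
    Measure.QuasiMeasurePreserving φ volume volume := by
  refine ⟨h.measurable_φ, Measure.AbsolutelyContinuous.mk fun s hs h0 => ?_⟩
  rw [Measure.map_apply h.measurable_φ hs]
  have h1 := h.lintegral_eq (s.indicator 1) (measurable_one.indicator hs)
  rw [lintegral_indicator_one hs, h0, lintegral_eq_zero_iff] at h1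
  · refine measure_eq_zero_iff_ae_notMem.2 ?_
    filter_upwards [h1, h.ne_zero] with x hx hw hmem
    have hm : φ x ∈ s := hmem
    simp [hm, hw] at hx
  · exact (h.measurable_w.enorm.pow_const 2).mul
      ((measurable_one.indicator hs).comp h.measurable_φ)

theorem IsIsoWeight.eLpNorm_eq {w : ℝ → ℂ} {φ : ℝ → ℝ} (h : IsIsoWeight w φ) {f : ℝ → ℂ}
    (hf : AEStronglyMeasurable f volume) :
    eLpNorm (fun x => w x * f (φ x)) 2 volume = eLpNorm f 2 volume := by
  have key : ∫⁻ x, ‖w x * f (φ x)‖ₑ ^ 2 = ∫⁻ x, ‖f x‖ₑ ^ 2 := by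
    have e1 : ∀ᵐ x : ℝ, f x = hf.mk f x := hf.ae_eq_mk
    have e2 : ∀ᵐ x : ℝ, f (φ x) = hf.mk f (φ x) := h.quasi.ae e1
    have h1 := h.lintegral_eq (fun x => ‖hf.mk f x‖ₑ ^ 2)
      (hf.stronglyMeasurable_mk.measurable.enorm.pow_const 2)
    calc ∫⁻ x, ‖w x * f (φ x)‖ₑ ^ 2 = ∫⁻ x, ‖w x‖ₑ ^ 2 * ‖hf.mk f (φ x)‖ₑ ^ 2 := by
          refine lintegral_congr_ae ?_
          filter_upwards [e2] with x hx
          rw [enorm_mul, mul_pow, hx]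
      _ = ∫⁻ x, ‖hf.mk f x‖ₑ ^ 2 := h1
      _ = ∫⁻ x, ‖f x‖ₑ ^ 2 := by
          refine lintegral_congr_ae ?_
          filter_upwards [e1] with x hx
          rw [hx]
  have e (g : ℝ → ℂ) : eLpNorm g 2 volume = (∫⁻ x, ‖g x‖ₑ ^ 2) ^ (1 / 2 : ℝ) := by
    rw [eLpNorm_eq_lintegral_rpow_enorm_toReal (by norm_num) (by norm_num)]
    simp
  rw [e, e, key]

theorem IsIsoWeight.memLp {w : ℝ → ℂ} {φ : ℝ → ℝ} (h : IsIsoWeight w φ) {f : ℝ → ℂ}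
    (hf : MemLp f 2 volume) : MemLp (fun x => w x * f (φ x)) 2 volume :=
  ⟨h.measurable_w.aestronglyMeasurable.mul (hf.1.comp_quasiMeasurePreserving h.quasi),
    by rw [h.eLpNorm_eq hf.1]; exact hf.2⟩

/-- The isometry `(T ψ)(x) = w(x) ψ(φ(x))` of `L²(ℝ)`. -/
noncomputable def IsIsoWeight.isometry {w : ℝ → ℂ} {φ : ℝ → ℝ} (h : IsIsoWeight w φ) :
    L2 →ₗᵢ[ℂ] L2 where
  toFun ψ := (h.memLp (Lp.memLp ψ)).toLp (fun x => w x * ψ (φ x))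
  map_add' ψ₁ ψ₂ := by
    rw [← MemLp.toLp_add]
    refine (MemLp.toLp_eq_toLp_iff _ _).2 ?_
    filter_upwards [h.quasi.ae (Lp.coeFn_add ψ₁ ψ₂)] with x hx
    simp only [hx, Pi.add_apply, mul_add]
  map_smul' c ψ := by
    rw [RingHom.id_apply, ← MemLp.toLp_const_smul]
    refine (MemLp.toLp_eq_toLp_iff _ _).2 ?_
    filter_upwards [h.quasi.ae (Lp.coeFn_smul c ψ)] with x hx
    simp only [hx, Pi.smul_apply, smul_eq_mul, mul_left_comm]
  norm_map' ψ := by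
    change ‖(h.memLp (Lp.memLp ψ)).toLp (fun x => w x * ψ (φ x))‖ = ‖ψ‖
    rw [Lp.norm_toLp, h.eLpNorm_eq (Lp.aestronglyMeasurable ψ), Lp.norm_def]

theorem IsIsoWeight.coeFn_isometry {w : ℝ → ℂ} {φ : ℝ → ℝ} (h : IsIsoWeight w φ) (ψ : L2) :
    h.isometry ψ =ᵐ[volume] fun x => w x * ψ (φ x) :=
  MemLp.coeFn_toLp (h.memLp (Lp.memLp ψ))

theorem IsIsoWeight.surjective {w w' : ℝ → ℂ} {φ φ' : ℝ → ℝ} (h : IsIsoWeight w φ)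
    (h' : IsIsoWeight w' φ') (hφ : ∀ x, φ' (φ x) = x) (hw : ∀ᵐ x : ℝ, w x * w' (φ x) = 1) :
    Function.Surjective h.isometry := by
  intro ψ
  refine ⟨h'.isometry ψ, Lp.ext ?_⟩
  filter_upwards [h.coeFn_isometry (h'.isometry ψ), h.quasi.ae (h'.coeFn_isometry ψ), hw]
    with x h1 h2 h3
  rw [h1, h2, hφ, ← mul_assoc, h3, one_mul]

/-- The unitary operator `(T ψ)(x) = w(x) ψ(φ(x))`, whose inverse is the weighted composition
operator with data `w'`, `φ'`. -/
noncomputable def IsIsoWeight.unitary {w w' : ℝ → ℂ} {φ φ' : ℝ → ℝ} (h : IsIsoWeight w φ)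
    (h' : IsIsoWeight w' φ') (hφ : ∀ x, φ' (φ x) = x) (hw : ∀ᵐ x : ℝ, w x * w' (φ x) = 1) :
    L2 ≃ₗᵢ[ℂ] L2 :=
  LinearIsometryEquiv.ofSurjective h.isometry (h.surjective h' hφ hw)

/-! ### The three unitary operators -/

theorem isIsoWeight_inversion : IsIsoWeight (fun x => (1 / x : ℂ)) (fun x => 1 / x) where
  measurable_w := by fun_prop
  measurable_φ := by fun_prop
  ne_zero := by
    filter_upwards [Measure.ae_ne volume (0 : ℝ)] with x hx
    simpa using hx
  lintegral_eq g _ := by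
    have him : (fun x : ℝ => x⁻¹) '' ({0}ᶜ : Set ℝ) = {0}ᶜ := by
      ext x
      constructor
      · rintro ⟨y, hy, rfl⟩
        simpa using hy
      · intro hx
        exact ⟨x⁻¹, by simpa using hx, inv_inv x⟩
    have h1 := lintegral_image_eq_lintegral_abs_deriv_mul (s := ({0}ᶜ : Set ℝ))
      (f := fun x : ℝ => x⁻¹) (f' := fun x => -(x ^ 2)⁻¹) (measurableSet_singleton 0).compl
      (fun x hx => (hasDerivAt_inv hx).hasDerivWithinAt) inv_injective.injOn g
    rw [him, restrict_compl_singleton] at h1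
    rw [h1]
    refine lintegral_congr fun x => ?_
    congr 1
    · rw [← ofReal_norm, ← ENNReal.ofReal_pow (norm_nonneg _)]
      congr 1
      simp
    · rw [one_div]

theorem isIsoWeight_translation (a : ℝ) : IsIsoWeight (fun _ => 1) (fun x => x - a) where
  measurable_w := by fun_prop
  measurable_φ := by fun_prop
  ne_zero := by simp
  lintegral_eq g _ := by
    simpa using lintegral_sub_right_eq_self g a

theorem isIsoWeight_dilation {c : ℝ} (hc : 0 < c) :
    IsIsoWeight (fun _ => ((Real.sqrt c : ℝ) : ℂ)) (fun x => c * x) where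
  measurable_w := by fun_prop
  measurable_φ := by fun_prop
  ne_zero := by
    refine Eventually.of_forall fun x => ?_
    simpa using (Real.sqrt_pos.2 hc).ne'
  lintegral_eq g hg := by
    have h1 : ∫⁻ x, g (c * x) = ENNReal.ofReal c⁻¹ * ∫⁻ x, g x := by
      rw [← lintegral_map hg (measurable_const_mul c), Real.map_volume_mul_left hc.ne',
        lintegral_smul_measure, abs_of_pos (inv_pos.2 hc), smul_eq_mul]
    have h2 : ‖((Real.sqrt c : ℝ) : ℂ)‖ₑ ^ 2 = ENNReal.ofReal c := by
      rw [← ofReal_norm, ← ENNReal.ofReal_pow (norm_nonneg _)]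
      congr 1
      simp [Real.sq_sqrt hc.le]
    rw [lintegral_const_mul' _ _ (by simp [h2]), h2, h1, ← mul_assoc,
      ← ENNReal.ofReal_mul hc.le, mul_inv_cancel₀ hc.ne', ENNReal.ofReal_one, one_mul]

/-- The unitary involution `(I ψ)(x) = (1/x) ψ(1/x)`. -/
noncomputable def inversion : L2 ≃ₗᵢ[ℂ] L2 :=
  isIsoWeight_inversion.unitary isIsoWeight_inversion (fun x => by simp) (by
    filter_upwards [Measure.ae_ne volume (0 : ℝ)] with x hx
    have : (x : ℂ) ≠ 0 := by exact_mod_cast hx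
    push_cast
    field_simp)

/-- The translation `(S_l ψ)(x) = ψ(x - 1/l)`. -/
noncomputable def translation (l : ℝ) : L2 ≃ₗᵢ[ℂ] L2 :=
  (isIsoWeight_translation (1 / l)).unitary (isIsoWeight_translation (-(1 / l)))
    (fun x => by ring) (by simp)

/-- The dilation `(D ψ)(x) = √c ψ(c x)`, for `c > 0`. -/
noncomputable def dilation (c : ℝ) (hc : 0 < c) : L2 ≃ₗᵢ[ℂ] L2 :=
  (isIsoWeight_dilation hc).unitary (isIsoWeight_dilation (inv_pos.2 hc))
    (fun x => by field_simp) (by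
      refine Eventually.of_forall fun x => ?_
      rw [← Complex.ofReal_mul, ← Real.sqrt_mul hc.le, mul_inv_cancel₀ hc.ne', Real.sqrt_one,
        Complex.ofReal_one])

/-- The unitary Fourier transform of `L²(ℝ)` in the normalization
`(F ψ)(k) = (2π)^(-1/2) ∫ e^(-ikx) ψ(x) dx`. Mathlib's Fourier transform `𝓕` is normalized by
`(𝓕 ψ)(ξ) = ∫ e^(-2πiξx) ψ(x) dx`, so `(F ψ)(k) = (2π)^(-1/2) (𝓕 ψ)(k / 2π)`. -/
noncomputable def fourier : L2 ≃ₗᵢ[ℂ] L2 :=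
  (Lp.fourierTransformₗᵢ ℝ ℂ).trans (dilation (2 * Real.pi)⁻¹ (inv_pos.2 Real.two_pi_pos))

theorem coeFn_inversion (ψ : L2) :
    inversion ψ =ᵐ[volume] fun x : ℝ => (1 / x : ℂ) * ψ (1 / x) :=
  isIsoWeight_inversion.coeFn_isometry ψ

theorem coeFn_translation (l : ℝ) (ψ : L2) :
    translation l ψ =ᵐ[volume] fun x : ℝ => ψ (x - 1 / l) := by
  have h := (isIsoWeight_translation (1 / l)).coeFn_isometry ψ
  simp only [one_mul] at h
  exact h

theorem coeFn_fourier (ψ : L2) :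
    fourier ψ =ᵐ[volume] fun k : ℝ =>
      (Real.sqrt (2 * Real.pi)⁻¹ : ℂ) * Lp.fourierTransformₗᵢ ℝ ℂ ψ ((2 * Real.pi)⁻¹ * k) :=
  (isIsoWeight_dilation (inv_pos.2 Real.two_pi_pos)).coeFn_isometry _

/-- `B = F* I F`; the adjoint of a unitary operator is its inverse. -/
noncomputable def B : L2 ≃ₗᵢ[ℂ] L2 :=
  (fourier.trans inversion).trans fourier.symm

/-- `B_l = S_l* B`. -/
noncomputable def Bshift (l : ℝ) : L2 ≃ₗᵢ[ℂ] L2 :=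
  B.trans (translation l).symm

/-! ### The integral kernel -/

/-- The Bessel function of the first kind of order zero, `∑ (-1)^k / (k!)² (t/2)^(2k)`. -/
noncomputable def besselJ0 (t : ℝ) : ℝ :=
  ∑' k : ℕ, (-1) ^ k / ((k.factorial : ℝ) ^ 2) * (t / 2) ^ (2 * k)

/-- The kernel `i (sgn x - sgn y) / 2 · J₀(2 √|xy|)`. -/
noncomputable def kernelB (x y : ℝ) : ℂ :=
  Complex.I * ((Real.sign x - Real.sign y : ℝ) / 2) *
    (besselJ0 (2 * Real.sqrt |x * y|) : ℂ)

/-! ### Principal values -/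

/-- The truncated line `[-R, -r] ∪ [r, R]`. -/
def truncLine (R r : ℝ) : Set ℝ := Set.Icc (-R) (-r) ∪ Set.Icc r R

/-- The principal value integral of `f` over `ℝ`, with singular points `0` and `∞`, exists and
equals `a`: the integrals over `[-R, -r] ∪ [r, R]` exist and tend to `a` as `R → ∞` and `r → 0+`,
jointly and independently of each other. -/
def HasPVIntegral (f : ℝ → ℂ) (a : ℂ) : Prop :=
  (∀ R r : ℝ, 0 < r → r < R → IntegrableOn f (truncLine R r) volume) ∧
    Tendsto (fun p : ℝ × ℝ => ∫ u in truncLine p.1 p.2, f u) (atTop ×ˢ 𝓝[>] (0 : ℝ)) (𝓝 a)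

/-- The function `u ↦ e^(ixu) e^(-iy/u) / u`. -/
noncomputable def oscillatory (x y u : ℝ) : ℂ :=
  Complex.exp (Complex.I * (x * u)) * Complex.exp (-(Complex.I * (y / u))) / u

end LuttingerB

namespace LuttingerB

open scoped FourierTransform SchwartzMap

/-! ### The Fourier transform on `L¹ ∩ L²` -/

/-! Inserting the Fourier integrals formally into `F* I F`, the kernel of `B` is `(2π)⁻¹ ∫ e^(ixu)
e^(-iy/u) / u du`, which converges only as a principal value. So the analysis lies in the limit and
in a bound for its truncations.

Adding the values at `u` and `-u` and putting `u = e^s` turns a truncation into `2i ∫ sin (x e^s - y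
e^(-s)) ds`. Cauchy's theorem for `exp (i (x e^z - y e^(-z)))` on a rectangle of height `π/2` writes
the sine integral as a difference of two vertical-side terms (`sinIntegral_eq_quarterIntegral_sub`),
with `A = x e^s + y e^(-s)` and `D = x e^s - y e^(-s)`. Such a term is at most `π/2` for `A ≥ 0`,
vanishes as `A → ∞`, and is `(π/2) J₀(D)` at `A = 0`. If `x, y ≥ 0`, then `A ≥ 0` throughout. If the
signs are opposite, `A` changes sign at one point, about which the integrand is symmetric; splitting
there produces `J₀`. Each half is at most `π`, which gives the bound `4π`.

For `ψ ∈ L¹ ∩ L²`, truncating `I F ψ` to `[-R, -r] ∪ [r, R]` makes it integrable, so Fubini applies.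
The truncations converge in `L²`, hence almost everywhere along a subsequence, while the uniform
bound gives pointwise convergence of the kernel integrals. The two limits coincide. -/

theorem integral_fourier_smul_eq {f g : ℝ → ℂ} (hf : Integrable f) (hg : Integrable g) :
    ∫ ξ, 𝓕 f ξ • g ξ = ∫ x, f x • 𝓕 g x := by
  have h := VectorFourier.integral_fourierIntegral_smul_eq_flip (μ := volume) (ν := volume)
    (L := innerₗ ℝ) Real.continuous_fourierChar continuous_inner hf hg
  rw [flip_innerₗ] at h
  exact h

theorem integral_fourierInv_smul_eq {f g : ℝ → ℂ} (hf : Integrable f) (hg : Integrable g) :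
    ∫ ξ, 𝓕⁻ f ξ • g ξ = ∫ x, f x • 𝓕⁻ g x := by
  rw [Real.fourierInv_eq_fourier_comp_neg, integral_fourier_smul_eq hf.comp_neg hg,
    ← integral_neg_eq_self]
  simp [Real.fourierInv_eq_fourier_neg]

theorem continuous_fourier_of_integrable {f : ℝ → ℂ} (hf : Integrable f) :
    Continuous (𝓕 f) :=
  VectorFourier.fourierIntegral_continuous Real.continuous_fourierChar continuous_inner hf

/-- On `L¹ ∩ L²` the Fourier transform of `L²` is the Fourier integral. -/
theorem fourierTransformₗᵢ_ae_eq {ψ : L2} (hψ : Integrable ψ) :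
    Lp.fourierTransformₗᵢ ℝ ℂ ψ =ᵐ[volume] 𝓕 (ψ : ℝ → ℂ) := by
  refine ae_eq_of_integral_contDiff_smul_eq
    ((Lp.memLp _).locallyIntegrable (by norm_num))
    (continuous_fourier_of_integrable hψ).locallyIntegrable fun g hg hgc => ?_
  have hcs : HasCompactSupport (fun x => (g x : ℂ)) := hgc.comp_left Complex.ofReal_zero
  let G : 𝓢(ℝ, ℂ) := hcs.toSchwartzMap (Complex.ofRealCLM.contDiff.comp hg)
  -- The `L²` transform agrees with that of tempered distributions, which is defined by duality, so
  -- it moves onto the test function.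
  have h1 : ∫ x, G x • (Lp.fourierTransformₗᵢ ℝ ℂ ψ) x = ∫ x, (𝓕 G) x • ψ x := by
    rw [← Lp.toTemperedDistribution_apply, ← Lp.toTemperedDistribution_apply,
      ← TemperedDistribution.fourier_apply, Lp.fourier_toTemperedDistribution_eq]
    rfl
  have h2 := integral_fourier_smul_eq hψ G.integrable
  calc ∫ x, g x • (Lp.fourierTransformₗᵢ ℝ ℂ ψ) x
      = ∫ x, G x • (Lp.fourierTransformₗᵢ ℝ ℂ ψ) x := rfl
    _ = ∫ x, (𝓕 G) x • ψ x := h1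
    _ = ∫ x, 𝓕 (ψ : ℝ → ℂ) x • G x := by
        rw [h2, SchwartzMap.fourier_coe]
        simp only [smul_eq_mul, mul_comm]
    _ = ∫ x, g x • 𝓕 (ψ : ℝ → ℂ) x := by
        refine integral_congr_ae (Eventually.of_forall fun x => ?_)
        change _ * ((g x : ℝ) : ℂ) = g x • _
        rw [Complex.real_smul, mul_comm]

theorem fourierTransformₗᵢ_symm_ae_eq {ψ : L2} (hψ : Integrable ψ) :
    (Lp.fourierTransformₗᵢ ℝ ℂ).symm ψ =ᵐ[volume] 𝓕⁻ (ψ : ℝ → ℂ) := by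
  have hcont : Continuous (𝓕⁻ (ψ : ℝ → ℂ)) := by
    rw [Real.fourierInv_eq_fourier_comp_neg]
    exact continuous_fourier_of_integrable hψ.comp_neg
  refine ae_eq_of_integral_contDiff_smul_eq
    ((Lp.memLp _).locallyIntegrable (by norm_num)) hcont.locallyIntegrable fun g hg hgc => ?_
  have hcs : HasCompactSupport (fun x => (g x : ℂ)) := hgc.comp_left Complex.ofReal_zero
  let G : 𝓢(ℝ, ℂ) := hcs.toSchwartzMap (Complex.ofRealCLM.contDiff.comp hg)
  have h1 : ∫ x, G x • ((Lp.fourierTransformₗᵢ ℝ ℂ).symm ψ) x = ∫ x, (𝓕⁻ G) x • ψ x := by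
    rw [← Lp.toTemperedDistribution_apply, ← Lp.toTemperedDistribution_apply,
      ← TemperedDistribution.fourierInv_apply, Lp.fourierInv_toTemperedDistribution_eq]
    rfl
  have h2 := integral_fourierInv_smul_eq hψ G.integrable
  calc ∫ x, g x • ((Lp.fourierTransformₗᵢ ℝ ℂ).symm ψ) x
      = ∫ x, G x • ((Lp.fourierTransformₗᵢ ℝ ℂ).symm ψ) x := rfl
    _ = ∫ x, (𝓕⁻ G) x • ψ x := h1
    _ = ∫ x, 𝓕⁻ (ψ : ℝ → ℂ) x • G x := by
        rw [h2, SchwartzMap.fourierInv_coe]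
        simp only [smul_eq_mul, mul_comm]
    _ = ∫ x, g x • 𝓕⁻ (ψ : ℝ → ℂ) x := by
        refine integral_congr_ae (Eventually.of_forall fun x => ?_)
        change _ * ((g x : ℝ) : ℂ) = g x • _
        rw [Complex.real_smul, mul_comm]

/-- `F ψ` is given by the Fourier integral when `ψ` is integrable. -/
theorem fourier_ae_eq {ψ : L2} (hψ : Integrable ψ) :
    fourier ψ =ᵐ[volume] fun k : ℝ => (Real.sqrt (2 * Real.pi)⁻¹ : ℂ) *
      ∫ y : ℝ, Complex.exp (-(Complex.I * (k * y))) * ψ y := by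
  have hq := (isIsoWeight_dilation (inv_pos.2 Real.two_pi_pos)).quasi
  filter_upwards [coeFn_fourier ψ, hq.ae (fourierTransformₗᵢ_ae_eq hψ)] with k h1 h2
  rw [h1, h2, Real.fourier_real_eq_integral_exp_smul]
  congr 1
  refine integral_congr_ae (Eventually.of_forall fun y => ?_)
  simp only [smul_eq_mul]
  congr 2
  push_cast
  have : (Real.pi : ℂ) ≠ 0 := by exact_mod_cast Real.pi_ne_zero
  field_simp

theorem coeFn_dilation {c : ℝ} (hc : 0 < c) (ψ : L2) :
    dilation c hc ψ =ᵐ[volume] fun x : ℝ => (Real.sqrt c : ℂ) * ψ (c * x) :=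
  (isIsoWeight_dilation hc).coeFn_isometry ψ

theorem dilation_symm {c : ℝ} (hc : 0 < c) (ψ : L2) :
    (dilation c hc).symm ψ = dilation c⁻¹ (inv_pos.2 hc) ψ := by
  rw [LinearIsometryEquiv.symm_apply_eq]
  refine Lp.ext ?_
  filter_upwards [coeFn_dilation hc (dilation c⁻¹ (inv_pos.2 hc) ψ),
    (isIsoWeight_dilation hc).quasi.ae (coeFn_dilation (inv_pos.2 hc) ψ)] with x h1 h2
  rw [h1, h2, ← mul_assoc, ← Complex.ofReal_mul, ← Real.sqrt_mul hc.le,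
    mul_inv_cancel₀ hc.ne', Real.sqrt_one, inv_mul_cancel_left₀ hc.ne', Complex.ofReal_one,
    one_mul]

/-- `F* ψ` is given by the inverse Fourier integral when `ψ` is integrable. -/
theorem fourier_symm_ae_eq {ψ : L2} (hψ : Integrable ψ) :
    fourier.symm ψ =ᵐ[volume] fun x : ℝ => (Real.sqrt (2 * Real.pi)⁻¹ : ℂ) *
      ∫ u : ℝ, Complex.exp (Complex.I * (x * u)) * ψ u := by
  have hπ := Real.two_pi_pos
  set D := dilation (2 * Real.pi)⁻¹⁻¹ (inv_pos.2 (inv_pos.2 hπ)) ψ with hD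
  have h0 : fourier.symm ψ = (Lp.fourierTransformₗᵢ ℝ ℂ).symm D := by
    rw [hD, ← dilation_symm (inv_pos.2 hπ)]
    rfl
  have hc := coeFn_dilation (inv_pos.2 (inv_pos.2 hπ)) ψ
  rw [← hD] at hc
  have hint : Integrable D :=
    ((hψ.comp_mul_left' (inv_pos.2 (inv_pos.2 hπ)).ne').const_mul _).congr hc.symm
  rw [h0]
  filter_upwards [fourierTransformₗᵢ_symm_ae_eq hint] with x hx
  rw [hx, Real.fourierInv_congr_ae hc, Real.fourierInv_eq']
  set s := (2 * Real.pi)⁻¹ with hs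
  have hs0 : 0 < s := inv_pos.2 hπ
  -- The substitution `u = 2πv` leaves the constant `(2π)⁻¹ √(2π) = (2π)^(-1/2)`.
  have h1 := Measure.integral_comp_mul_left
    (fun u : ℝ => (Real.sqrt s⁻¹ : ℂ) * (Complex.exp (Complex.I * (x * u)) * ψ u)) s⁻¹
  calc _ = ∫ v : ℝ, (Real.sqrt s⁻¹ : ℂ) * (Complex.exp (Complex.I * (x * (s⁻¹ * v : ℝ)))
            * ψ (s⁻¹ * v)) := by
        refine integral_congr_ae (Eventually.of_forall fun y => ?_)
        simp only [smul_eq_mul, hs, inv_inv]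
        rw [mul_left_comm]
        congr 3
        push_cast
        simp
        ring
    _ = _ := by
        rw [h1, integral_const_mul, inv_inv, abs_of_pos hs0, Complex.real_smul, ← mul_assoc,
          ← Complex.ofReal_mul]
        congr 2
        rw [Real.sqrt_inv]
        have := Real.mul_self_sqrt hs0.le
        have := (Real.sqrt_pos.2 hs0).ne'
        field_simp
        nlinarith

/-! ### The integral of `sin (x e^s - y e^(-s))` -/

/-- The integral of `e^(-A sin θ) cos (D cos θ)` over the quarter circle. -/
noncomputable def quarterIntegral (A D : ℝ) : ℝ :=
  ∫ θ in (0 : ℝ)..(Real.pi / 2), Real.exp (-(A * Real.sin θ)) * Real.cos (D * Real.cos θ)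

/-- The integral of `sin (x e^s - y e^(-s))` from `a` to `b`. -/
noncomputable def sinIntegral (x y a b : ℝ) : ℝ :=
  ∫ s in a..b, Real.sin (x * Real.exp s - y * Real.exp (-s))

/-- Cauchy's theorem on `[a, b] × [0, π/2]`, imaginary parts taken: the bottom edge gives the sine
integral, the top edge nothing, the vertical edges the quarter integrals. -/
theorem sinIntegral_eq_quarterIntegral_sub (x y a b : ℝ) :
    sinIntegral x y a b =
      quarterIntegral (x * Real.exp a + y * Real.exp (-a)) (x * Real.exp a - y * Real.exp (-a)) -
      quarterIntegral (x * Real.exp b + y * Real.exp (-b)) (x * Real.exp b - y * Real.exp (-b)) := by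
  let G : ℂ → ℂ := fun z => Complex.exp (Complex.I * (x * Complex.exp z - y * Complex.exp (-z)))
  have hGc : Continuous G := by fun_prop
  have hG : Differentiable ℂ G := by fun_prop
  have hrect := Complex.integral_boundary_rect_eq_zero_of_differentiableOn G (a : ℂ)
    (b + (Real.pi / 2 : ℝ) * Complex.I) hG.differentiableOn
  simp only [Complex.ofReal_re, Complex.ofReal_im, Complex.add_re, Complex.add_im,
    Complex.mul_re, Complex.mul_im, Complex.I_re, Complex.I_im, mul_zero, mul_one, sub_zero,
    add_zero, zero_add, Complex.ofReal_zero, zero_mul] at hrect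
  have arg (s θ : ℝ) : Complex.I * (x * Complex.exp (s + θ * Complex.I)
      - y * Complex.exp (-(s + θ * Complex.I))) =
      ((-((x * Real.exp s + y * Real.exp (-s)) * Real.sin θ) : ℝ) : ℂ) +
      (((x * Real.exp s - y * Real.exp (-s)) * Real.cos θ : ℝ) : ℂ) * Complex.I := by
    rw [neg_add, ← neg_mul, Complex.exp_add, Complex.exp_add, Complex.exp_mul_I,
      Complex.exp_mul_I, Complex.cos_neg, Complex.sin_neg]
    push_cast
    linear_combination (x * Complex.exp s * Complex.sin θ + y * Complex.exp (-s) * Complex.sin θ)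
      * Complex.I_mul_I
  have him (f : ℝ → ℂ) (hf : Continuous f) (c d : ℝ) :
      (∫ t in c..d, f t).im = ∫ t in c..d, (f t).im :=
    (Complex.imCLM.intervalIntegral_comp_comm (hf.intervalIntegrable c d)).symm
  have hre (f : ℝ → ℂ) (hf : Continuous f) (c d : ℝ) :
      (∫ t in c..d, f t).re = ∫ t in c..d, (f t).re :=
    (Complex.reCLM.intervalIntegral_comp_comm (hf.intervalIntegrable c d)).symm
  have hvert (s : ℝ) : (∫ θ in (0 : ℝ)..(Real.pi / 2), G (s + θ * Complex.I)).re =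
      quarterIntegral (x * Real.exp s + y * Real.exp (-s))
        (x * Real.exp s - y * Real.exp (-s)) := by
    rw [hre _ (by fun_prop)]
    refine intervalIntegral.integral_congr fun θ _ => ?_
    simp only [G]
    rw [arg, Complex.exp_add, ← Complex.ofReal_exp, Complex.re_ofReal_mul,
      Complex.exp_ofReal_mul_I_re]
  have hbot : (∫ s in a..b, G s).im = sinIntegral x y a b := by
    rw [him _ (by fun_prop)]
    refine intervalIntegral.integral_congr fun s _ => ?_
    have := arg s 0
    simp only [Complex.ofReal_zero, zero_mul, add_zero, Real.sin_zero, Real.cos_zero, mul_zero,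
      mul_one, neg_zero, zero_add] at this
    simp only [G]
    rw [this, Complex.exp_ofReal_mul_I_im]
  -- At height `π/2` the exponent is `-(x e^s + y e^(-s))`, so the integrand is real.
  have htop : (∫ s in a..b, G (s + (Real.pi / 2 : ℝ) * Complex.I)).im = 0 := by
    rw [him _ (by fun_prop)]
    refine (intervalIntegral.integral_congr fun s _ => ?_).trans intervalIntegral.integral_zero
    simp only [G]
    rw [arg, Real.cos_pi_div_two, mul_zero, Complex.ofReal_zero, zero_mul, add_zero,
      ← Complex.ofReal_exp, Complex.ofReal_im]
  have h := congrArg Complex.im hrect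
  simp only [Complex.sub_im, Complex.add_im, smul_eq_mul, Complex.I_mul_im, hvert, hbot, htop,
    Complex.zero_im] at h
  linarith

theorem continuous_quarterIntegral : Continuous fun p : ℝ × ℝ => quarterIntegral p.1 p.2 := by
  unfold quarterIntegral
  apply intervalIntegral.continuous_parametric_intervalIntegral_of_continuous'
  fun_prop

theorem quarterIntegral_zero_zero : quarterIntegral 0 0 = Real.pi / 2 := by
  simp [quarterIntegral]

theorem quarterIntegral_neg_right (A D : ℝ) : quarterIntegral A (-D) = quarterIntegral A D := by
  simp [quarterIntegral]

theorem sin_nonneg_of_mem_quarter {θ : ℝ} (hθ : θ ∈ Set.uIoc 0 (Real.pi / 2)) :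
    0 ≤ Real.sin θ := by
  rw [Set.uIoc_of_le (by positivity)] at hθ
  exact Real.sin_nonneg_of_nonneg_of_le_pi hθ.1.le (by linarith [hθ.2, Real.pi_pos])

theorem abs_quarterIntegral_le {A : ℝ} (hA : 0 ≤ A) (D : ℝ) :
    |quarterIntegral A D| ≤ Real.pi / 2 := by
  have h := intervalIntegral.norm_integral_le_of_norm_le_const (a := 0) (b := Real.pi / 2) (C := 1)
    (f := fun θ => Real.exp (-(A * Real.sin θ)) * Real.cos (D * Real.cos θ)) fun θ hθ => by
      rw [norm_mul, Real.norm_eq_abs, Real.norm_eq_abs, Real.abs_exp]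
      refine mul_le_one₀ ?_ (abs_nonneg _) (Real.abs_cos_le_one _)
      rw [Real.exp_le_one_iff]
      have := mul_nonneg hA (sin_nonneg_of_mem_quarter hθ)
      linarith
  rwa [sub_zero, abs_of_pos (by positivity), one_mul] at h

/-- Jordan's inequality `sin θ ≥ 2θ/π` bounds the integrand by `exp (-(2A/π) θ)`, uniformly in `D`.
-/
theorem abs_quarterIntegral_le_div {A : ℝ} (hA : 0 < A) (D : ℝ) :
    |quarterIntegral A D| ≤ Real.pi / (2 * A) := by
  have hπ := Real.pi_pos
  set c := 2 / Real.pi * A with hc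
  have hc0 : 0 < c := by positivity
  have h1 : |quarterIntegral A D| ≤ ∫ θ in (0 : ℝ)..(Real.pi / 2), Real.exp (-c * θ) := by
    refine intervalIntegral.norm_integral_le_of_norm_le (μ := volume)
      (f := fun θ => Real.exp (-(A * Real.sin θ)) * Real.cos (D * Real.cos θ)) (by positivity)
      (Eventually.of_forall fun θ hθ => ?_)
      (Continuous.intervalIntegrable (μ := volume) (u := fun θ => Real.exp (-c * θ)) (by fun_prop) _ _)
    rw [norm_mul, Real.norm_eq_abs, Real.norm_eq_abs, Real.abs_exp]
    refine (mul_le_of_le_one_right (Real.exp_nonneg _) (Real.abs_cos_le_one _)).trans ?_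
    rw [Real.exp_le_exp]
    have := mul_le_mul_of_nonneg_left (Real.mul_le_sin hθ.1.le hθ.2) hA.le
    rw [hc]
    linarith
  have h2 : ∫ θ in (0 : ℝ)..(Real.pi / 2), Real.exp (-c * θ) ≤ 1 / c := by
    rw [intervalIntegral.integral_comp_mul_left (fun t => Real.exp t) (neg_ne_zero.2 hc0.ne'),
      integral_exp, mul_zero, Real.exp_zero, smul_eq_mul, inv_neg, neg_mul, ← mul_neg, neg_sub,
      ← one_div]
    exact mul_le_of_le_one_right (by positivity) (by linarith [Real.exp_nonneg (-c * (Real.pi / 2))])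
  refine (h1.trans h2).trans_eq ?_
  rw [hc]
  field_simp

theorem tendsto_quarterIntegral {ι : Type*} {l : Filter ι} {A D : ι → ℝ} {A₀ D₀ : ℝ}
    (hA : Tendsto A l (𝓝 A₀)) (hD : Tendsto D l (𝓝 D₀)) :
    Tendsto (fun i => quarterIntegral (A i) (D i)) l (𝓝 (quarterIntegral A₀ D₀)) :=
  (continuous_quarterIntegral.tendsto (A₀, D₀)).comp (hA.prodMk_nhds hD)

theorem tendsto_quarterIntegral_zero {ι : Type*} {l : Filter ι} {A D : ι → ℝ}
    (hA : Tendsto A l atTop) : Tendsto (fun i => quarterIntegral (A i) (D i)) l (𝓝 0) := by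
  have h : Tendsto (fun i => Real.pi / (2 * A i)) l (𝓝 0) :=
    (hA.const_mul_atTop two_pos).const_div_atTop Real.pi
  refine squeeze_zero_norm' ?_ h
  filter_upwards [hA.eventually_gt_atTop 0] with i hi
  exact abs_quarterIntegral_le_div hi _


/-! ### Quarter integrals and the Bessel function -/

theorem prod_odd_div_even (n : ℕ) :
    (∏ i ∈ Finset.range n, (2 * (i : ℝ) + 1) / (2 * i + 2)) =
      (2 * n).factorial / (4 ^ n * (n.factorial : ℝ) ^ 2) := by
  induction n with
  | zero => simp
  | succ n ih =>
    rw [Finset.prod_range_succ, ih, show 2 * (n + 1) = 2 * n + 1 + 1 by ring,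
      Nat.factorial_succ, Nat.factorial_succ, Nat.factorial_succ]
    have := n.factorial_pos
    push_cast
    field_simp
    ring

theorem integral_cos_pow_even (n : ℕ) :
    ∫ θ in (0 : ℝ)..(Real.pi / 2), Real.cos θ ^ (2 * n) =
      Real.pi / 2 * ((2 * n).factorial / (4 ^ n * (n.factorial : ℝ) ^ 2)) := by
  rw [EulerSine.integral_cos_pow_eq, integral_sin_pow_even, prod_odd_div_even]
  ring

/-- Termwise integration of the cosine series: the factor `(2n)!` in Wallis's formula cancels that
of the cosine coefficient and leaves the Bessel series. -/
theorem quarterIntegral_zero_left (D : ℝ) :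
    quarterIntegral 0 D = Real.pi / 2 * besselJ0 D := by
  have hterm (n : ℕ) : ∫ θ in (0 : ℝ)..(Real.pi / 2),
      (-1) ^ n * (D * Real.cos θ) ^ (2 * n) / ((2 * n).factorial : ℝ) =
      Real.pi / 2 * ((-1) ^ n / ((n.factorial : ℝ) ^ 2) * (D / 2) ^ (2 * n)) := by
    have (θ : ℝ) : (-1) ^ n * (D * Real.cos θ) ^ (2 * n) / ((2 * n).factorial : ℝ) =
        (-1) ^ n * D ^ (2 * n) / ((2 * n).factorial : ℝ) * Real.cos θ ^ (2 * n) := by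
      rw [mul_pow]; ring
    simp only [this]
    rw [intervalIntegral.integral_const_mul, integral_cos_pow_even, div_pow, pow_mul (2 : ℝ) 2 n]
    have := (2 * n).factorial_pos
    have := n.factorial_pos
    norm_num
    field_simp
  have h := intervalIntegral.hasSum_integral_of_dominated_convergence
    (μ := volume) (a := 0) (b := Real.pi / 2)
    (F := fun (n : ℕ) θ => (-1) ^ n * (D * Real.cos θ) ^ (2 * n) / ((2 * n).factorial : ℝ))
    (f := fun θ => Real.cos (D * Real.cos θ))
    (fun n _ => |D| ^ (2 * n) / ((2 * n).factorial : ℝ))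
    (fun n => (by fun_prop : Continuous _).aestronglyMeasurable)
    (fun n => Eventually.of_forall fun θ _ => by
      rw [norm_div, norm_mul, norm_pow, norm_neg, norm_one, one_pow, one_mul, norm_pow, norm_mul,
        Real.norm_natCast, Real.norm_eq_abs, Real.norm_eq_abs]
      gcongr
      exact mul_le_of_le_one_right (abs_nonneg _) (Real.abs_cos_le_one _))
    (Eventually.of_forall fun θ _ => (Real.summable_pow_div_factorial |D|).comp_injective
      (mul_right_injective₀ (two_ne_zero' ℕ)))
    intervalIntegrable_const
    (Eventually.of_forall fun θ _ => Real.hasSum_cos _)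
  simp only [hterm] at h
  rw [besselJ0, ← tsum_mul_left, h.tsum_eq]
  simp [quarterIntegral]

theorem besselJ0_zero : besselJ0 0 = 1 := by
  have h := quarterIntegral_zero_left 0
  rw [quarterIntegral_zero_zero] at h
  have := Real.pi_pos
  field_simp at h
  linarith

/-! ### Symmetries and centring of the phase -/

theorem sinIntegral_neg_neg (x y a b : ℝ) : sinIntegral (-x) (-y) a b = -sinIntegral x y a b := by
  rw [sinIntegral, sinIntegral, ← intervalIntegral.integral_neg]
  refine intervalIntegral.integral_congr fun s _ => ?_
  rw [← Real.sin_neg]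
  ring_nf

theorem sinIntegral_add_adjacent (x y a b c : ℝ) :
    sinIntegral x y a b + sinIntegral x y b c = sinIntegral x y a c :=
  intervalIntegral.integral_add_adjacent_intervals
    (Continuous.intervalIntegrable (by fun_prop) _ _)
    (Continuous.intervalIntegrable (by fun_prop) _ _)

theorem sinIntegral_shift (x y a b c : ℝ) :
    sinIntegral (x * Real.exp c) (y * Real.exp (-c)) a b = sinIntegral x y (a + c) (b + c) := by
  rw [sinIntegral, sinIntegral, ← intervalIntegral.integral_comp_add_right]
  refine intervalIntegral.integral_congr fun s _ => ?_
  rw [neg_add, Real.exp_add, Real.exp_add]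
  ring_nf

/-- The phase `m (e^s + e^(-s))` is even in `s`. -/
theorem sinIntegral_zero_neg (m b : ℝ) :
    sinIntegral m (-m) 0 (-b) = -sinIntegral m (-m) 0 b := by
  have h := intervalIntegral.integral_comp_neg (a := 0) (b := b)
    (fun s => Real.sin (m * Real.exp s - -m * Real.exp (-s)))
  rw [neg_zero] at h
  rw [sinIntegral, sinIntegral, intervalIntegral.integral_symm (-b) 0, ← h, neg_inj]
  refine intervalIntegral.integral_congr fun s _ => ?_
  simp only [neg_neg]
  ring_nf

/-- At the centre `s = 0` the damping parameter `A` is zero and `D = 2m`; this endpoint is the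
source of `J₀`. -/
theorem sinIntegral_symm_eq (m b : ℝ) :
    sinIntegral m (-m) 0 b = Real.pi / 2 * besselJ0 (2 * m) -
      quarterIntegral (m * Real.exp b - m * Real.exp (-b))
        (m * Real.exp b + m * Real.exp (-b)) := by
  rw [sinIntegral_eq_quarterIntegral_sub, ← quarterIntegral_zero_left]
  simp only [neg_zero, Real.exp_zero, mul_one, neg_mul, sub_neg_eq_add, ← sub_eq_add_neg, sub_self,
    two_mul]

theorem abs_sinIntegral_symm_le {m : ℝ} (hm : 0 ≤ m) (b : ℝ) :
    |sinIntegral m (-m) 0 b| ≤ Real.pi := by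
  wlog hb : 0 ≤ b generalizing b
  -- Evenness reduces to `b ≥ 0`, where `A = m (e^b - e^(-b))` is nonnegative and the bound `π/2`
  -- applies at both ends.
  · have := this (-b) (by linarith)
    rwa [sinIntegral_zero_neg, abs_neg] at this
  rw [sinIntegral_symm_eq, ← quarterIntegral_zero_left]
  have h1 := abs_quarterIntegral_le le_rfl (2 * m)
  have h2 := abs_quarterIntegral_le (A := m * Real.exp b - m * Real.exp (-b))
    (by rw [← mul_sub]
        exact mul_nonneg hm (sub_nonneg.2 (Real.exp_le_exp.2 (by linarith))))
    (m * Real.exp b + m * Real.exp (-b))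
  exact (abs_sub _ _).trans (by linarith)

theorem tendsto_sinIntegral_symm_atTop {m : ℝ} (hm : 0 < m) :
    Tendsto (fun b => sinIntegral m (-m) 0 b) atTop (𝓝 (Real.pi / 2 * besselJ0 (2 * m))) := by
  simp only [sinIntegral_symm_eq]
  have h : Tendsto (fun b => m * Real.exp b - m * Real.exp (-b)) atTop atTop := by
    simp only [sub_eq_add_neg]
    exact (Real.tendsto_exp_atTop.const_mul_atTop hm).atTop_add
      ((Real.tendsto_exp_neg_atTop_nhds_zero.const_mul m).neg)
  simpa using tendsto_const_nhds.sub (tendsto_quarterIntegral_zero h)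

/-- The centre `c` of the phase `x e^s + y e^(-s)`. -/
theorem exists_sinIntegral_eq_symm {x y : ℝ} (hx : 0 < x) (hy : 0 < y) :
    ∃ c : ℝ, ∀ a b, sinIntegral x (-y) a b =
      sinIntegral (Real.sqrt (x * y)) (-Real.sqrt (x * y)) 0 (b - c) -
      sinIntegral (Real.sqrt (x * y)) (-Real.sqrt (x * y)) 0 (a - c) := by
  have hq : 0 < Real.sqrt (y / x) := Real.sqrt_pos.2 (by positivity)
  -- This `c` solves `x e^c = y e^(-c)`; the common value is `√(xy)`.
  refine ⟨Real.log (Real.sqrt (y / x)), fun a b => ?_⟩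
  set c := Real.log (Real.sqrt (y / x)) with hc
  have e1 : x * Real.exp c = Real.sqrt (x * y) := by
    rw [hc, Real.exp_log hq, eq_comm, Real.sqrt_eq_iff_mul_self_eq (by positivity) (by positivity)]
    have := Real.mul_self_sqrt (show 0 ≤ y / x by positivity)
    calc x * y = x * x * (y / x) := by field_simp
      _ = x * x * (Real.sqrt (y / x) * Real.sqrt (y / x)) := by rw [this]
      _ = _ := by ring
  have e2 : y * Real.exp (-c) = Real.sqrt (x * y) := by
    rw [Real.exp_neg, ← div_eq_mul_inv, div_eq_iff (Real.exp_pos _).ne']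
    refine mul_left_cancel₀ hx.ne' ?_
    rw [mul_left_comm, e1, Real.mul_self_sqrt (by positivity)]
  have h := sinIntegral_shift x (-y) (a - c) (b - c) c
  rw [sub_add_cancel, sub_add_cancel, neg_mul, e1, e2] at h
  rw [← h, eq_sub_iff_add_eq, add_comm, sinIntegral_add_adjacent]

/-! ### Uniform bound and limit of the sine integral -/

theorem abs_sinIntegral_le (x y a b : ℝ) : |sinIntegral x y a b| ≤ 2 * Real.pi := by
  wlog hx : 0 ≤ x generalizing x y
  · have := this (-x) (-y) (by linarith)
    rwa [sinIntegral_neg_neg, abs_neg] at this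
  have hπ := Real.pi_pos
  have of_nonneg {x y : ℝ} (hx : 0 ≤ x) (hy : 0 ≤ y) : |sinIntegral x y a b| ≤ 2 * Real.pi := by
    rw [sinIntegral_eq_quarterIntegral_sub]
    exact (abs_sub _ _).trans ((add_le_add (abs_quarterIntegral_le (by positivity) _)
      (abs_quarterIntegral_le (by positivity) _)).trans (by linarith))
  rcases le_or_gt 0 y with hy | hy
  · exact of_nonneg hx hy
  rcases hx.eq_or_lt with rfl | hx
  -- Since `-0 = 0`, negating both parameters returns to the closed positive quadrant.
  · have := of_nonneg le_rfl (neg_nonneg.2 hy.le)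
    rwa [← neg_zero, sinIntegral_neg_neg, abs_neg] at this
  obtain ⟨c, hc⟩ := exists_sinIntegral_eq_symm hx (neg_pos.2 hy)
  rw [neg_neg] at hc
  rw [hc]
  exact (abs_sub _ _).trans ((add_le_add (abs_sinIntegral_symm_le (Real.sqrt_nonneg _) _)
    (abs_sinIntegral_symm_le (Real.sqrt_nonneg _) _)).trans (by linarith))

/-- An endpoint term vanishes in the limit if its growing exponential has a positive coefficient;
otherwise `A, D → 0` and it tends to `π/2`. Thus the limit is `(π/2)(sgn x - sgn y)`. The factor
`J₀` is harmless: the signs differ only when `xy = 0`, and `J₀(0) = 1`. -/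
theorem tendsto_sinIntegral_of_nonneg {x y : ℝ} (hx : 0 ≤ x) (hy : 0 ≤ y) :
    Tendsto (fun p : ℝ × ℝ => sinIntegral x y p.1 p.2) (atBot ×ˢ atTop)
      (𝓝 (Real.pi * ((Real.sign x - Real.sign y) / 2) *
        besselJ0 (2 * Real.sqrt |x * y|))) := by
  have atTop_part {x y : ℝ} (hx : 0 ≤ x) (hy : 0 ≤ y) :
      Tendsto (fun b => quarterIntegral (x * Real.exp b + y * Real.exp (-b))
        (x * Real.exp b - y * Real.exp (-b))) atTop (𝓝 (Real.pi / 2 * (1 - Real.sign x))) := by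
    have hd : Tendsto (fun b => y * Real.exp (-b)) atTop (𝓝 0) := by
      simpa using Real.tendsto_exp_neg_atTop_nhds_zero.const_mul y
    rcases hx.eq_or_lt with rfl | hx
    · simp only [zero_mul, zero_add, zero_sub, Real.sign_zero, sub_zero, mul_one,
        quarterIntegral_neg_right]
      rw [← quarterIntegral_zero_zero]
      exact tendsto_quarterIntegral hd hd
    · rw [Real.sign_of_pos hx, sub_self, mul_zero]
      exact tendsto_quarterIntegral_zero
        ((Real.tendsto_exp_atTop.const_mul_atTop hx).atTop_add hd)
  -- The reflection `s ↦ -s` exchanges `x` and `y` and changes the sign of `D`, in which the quarter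
  -- integral is even.
  have atBot_part : Tendsto (fun a => quarterIntegral (x * Real.exp a + y * Real.exp (-a))
      (x * Real.exp a - y * Real.exp (-a))) atBot (𝓝 (Real.pi / 2 * (1 - Real.sign y))) := by
    refine ((atTop_part hy hx).comp tendsto_neg_atBot_atTop).congr fun a => ?_
    rw [Function.comp_apply, neg_neg, ← quarterIntegral_neg_right, neg_sub, add_comm]
  simp only [sinIntegral_eq_quarterIntegral_sub]
  have h := (atBot_part.comp tendsto_fst).sub ((atTop_part hx hy).comp tendsto_snd)
  convert h using 2
  · rfl
  rcases hx.eq_or_lt with rfl | hx'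
  · rw [zero_mul, abs_zero, Real.sqrt_zero, mul_zero, besselJ0_zero]
    ring
  rcases hy.eq_or_lt with rfl | hy'
  · rw [mul_zero, abs_zero, Real.sqrt_zero, mul_zero, besselJ0_zero]
    ring
  rw [Real.sign_of_pos hx', Real.sign_of_pos hy']
  ring

theorem tendsto_sinIntegral (x y : ℝ) :
    Tendsto (fun p : ℝ × ℝ => sinIntegral x y p.1 p.2) (atBot ×ˢ atTop)
      (𝓝 (Real.pi * ((Real.sign x - Real.sign y) / 2) *
        besselJ0 (2 * Real.sqrt |x * y|))) := by
  have of_neg {x y : ℝ} (h : Tendsto (fun p : ℝ × ℝ => sinIntegral (-x) (-y) p.1 p.2)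
      (atBot ×ˢ atTop) (𝓝 (Real.pi * ((Real.sign (-x) - Real.sign (-y)) / 2) *
        besselJ0 (2 * Real.sqrt |-x * -y|)))) :
      Tendsto (fun p : ℝ × ℝ => sinIntegral x y p.1 p.2) (atBot ×ˢ atTop)
        (𝓝 (Real.pi * ((Real.sign x - Real.sign y) / 2) *
          besselJ0 (2 * Real.sqrt |x * y|))) := by
    have h' := h.neg
    simp only [sinIntegral_neg_neg, neg_neg, Real.sign_neg, neg_mul_neg] at h'
    convert h' using 2
    ring
  wlog hx : 0 ≤ x generalizing x y
  · exact of_neg (this (-x) (-y) (by linarith))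
  rcases le_or_gt 0 y with hy | hy
  · exact tendsto_sinIntegral_of_nonneg hx hy
  rcases hx.eq_or_lt with rfl | hx
  · exact of_neg (tendsto_sinIntegral_of_nonneg (by simp) (by linarith))
  obtain ⟨c, hc⟩ := exists_sinIntegral_eq_symm hx (neg_pos.2 hy)
  rw [neg_neg] at hc
  simp only [hc]
  have hm : 0 < Real.sqrt (x * -y) := Real.sqrt_pos.2 (mul_pos hx (neg_pos.2 hy))
  have h1 := (tendsto_sinIntegral_symm_atTop hm).comp (tendsto_atTop_add_const_right _ (-c)
    tendsto_id)
  have h2 := (tendsto_sinIntegral_symm_atTop hm).comp ((tendsto_atTop_add_const_right _ c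
    tendsto_neg_atBot_atTop))
  -- Each half, on either side of the centre, contributes `(π/2) J₀(2√|xy|)`.
  have h := (h1.comp (tendsto_snd (f := (atBot : Filter ℝ)))).add
    (h2.comp (tendsto_fst (g := (atTop : Filter ℝ))))
  have he : |x * y| = x * -y := by rw [abs_of_neg (mul_neg_of_pos_of_neg hx hy)]; ring
  rw [Real.sign_of_pos hx, Real.sign_of_neg hy, he]
  convert h using 2
  · rename_i p
    simp only [Function.comp_apply, id]
    rw [show -p.1 + c = -(p.1 - c) by ring, sinIntegral_zero_neg, ← sub_eq_add_neg,
      ← sub_eq_add_neg]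
  · ring

/-! ### The truncated oscillatory integrals -/

theorem isCompact_truncLine (R r : ℝ) : IsCompact (truncLine R r) :=
  isCompact_Icc.union isCompact_Icc

theorem measurableSet_truncLine (R r : ℝ) : MeasurableSet (truncLine R r) :=
  (isCompact_truncLine R r).measurableSet

theorem ne_zero_of_mem_truncLine {R r u : ℝ} (hr : 0 < r) (hu : u ∈ truncLine R r) : u ≠ 0 := by
  rcases hu with hu | hu
  · exact (hu.2.trans_lt (neg_neg_of_pos hr)).ne
  · exact (hr.trans_le hu.1).ne'

theorem continuousOn_oscillatory (x y : ℝ) : ContinuousOn (oscillatory x y) {0}ᶜ := by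
  intro u hu
  have hu' : (u : ℂ) ≠ 0 := by exact_mod_cast hu
  refine ContinuousAt.continuousWithinAt ?_
  unfold oscillatory
  fun_prop (disch := assumption)

theorem integrableOn_oscillatory (x y R : ℝ) {r : ℝ} (hr : 0 < r) :
    IntegrableOn (oscillatory x y) (truncLine R r) :=
  ((continuousOn_oscillatory x y).mono fun _ hu =>
    ne_zero_of_mem_truncLine hr hu).integrableOn_compact (isCompact_truncLine R r)

theorem oscillatory_add_neg (x y u : ℝ) :
    oscillatory x y u + oscillatory x y (-u) =
      2 * Complex.I * ((Real.sin (x * u - y / u) * u⁻¹ : ℝ) : ℂ) := by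
  have key (v : ℝ) : oscillatory x y v =
      Complex.exp (((x * v - y / v : ℝ) : ℂ) * Complex.I) * (v : ℂ)⁻¹ := by
    rw [oscillatory, ← Complex.exp_add, div_eq_mul_inv]
    congr 2
    push_cast
    ring
  rw [key, key, show x * -u - y / -u = -(x * u - y / u) by rw [div_neg]; ring]
  push_cast
  rw [neg_mul, Complex.sin, inv_neg, neg_mul]
  linear_combination (Complex.exp ((x * u - y / u) * Complex.I) -
    Complex.exp (-((x * u - y / u) * Complex.I))) * (u : ℂ)⁻¹ * Complex.I_mul_I

theorem sinIntegral_log (x y : ℝ) {r R : ℝ} (hr : 0 < r) (hrR : r < R) :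
    sinIntegral x y (Real.log r) (Real.log R) =
      ∫ u in r..R, Real.sin (x * u - y / u) * u⁻¹ := by
  have hg : ContinuousOn (fun u : ℝ => Real.sin (x * u - y / u) * u⁻¹)
      (Real.exp '' Set.uIcc (Real.log r) (Real.log R)) := by
    rintro _ ⟨s, _, rfl⟩
    have := Real.exp_ne_zero s
    refine ContinuousAt.continuousWithinAt ?_
    fun_prop (disch := assumption)
  have h := intervalIntegral.integral_comp_mul_deriv' (f := Real.exp) (f' := Real.exp)
    (fun s _ => Real.hasDerivAt_exp s) Real.continuous_exp.continuousOn hg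
  rw [Real.exp_log hr, Real.exp_log (hr.trans hrR)] at h
  rw [← h]
  refine intervalIntegral.integral_congr fun s _ => ?_
  have := Real.exp_ne_zero s
  simp only [Function.comp_apply, Real.exp_neg]
  field_simp

/-- Reflecting the negative half onto `[r, R]` cancels the cosine part, and `u = e^s` absorbs
`du/u`. -/
theorem setIntegral_oscillatory (x y : ℝ) {r R : ℝ} (hr : 0 < r) (hrR : r < R) :
    ∫ u in truncLine R r, oscillatory x y u =
      2 * Complex.I * (sinIntegral x y (Real.log r) (Real.log R) : ℂ) := by
  have hint := integrableOn_oscillatory x y R hr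
  have hdisj : Disjoint (Set.Icc (-R) (-r)) (Set.Icc r R) :=
    Set.disjoint_left.2 fun u h1 h2 => by linarith [h1.2, h2.1]
  have hpos : IntervalIntegrable (oscillatory x y) volume r R :=
    (intervalIntegrable_iff_integrableOn_Icc_of_le hrR.le).2
      (hint.mono_set Set.subset_union_right)
  have hneg : IntervalIntegrable (oscillatory x y) volume (-R) (-r) :=
    (intervalIntegrable_iff_integrableOn_Icc_of_le (by linarith)).2
      (hint.mono_set Set.subset_union_left)
  have hneg' : IntervalIntegrable (fun u => oscillatory x y (-u)) volume r R := by
    rw [IntervalIntegrable.iff_comp_neg]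
    simpa only [neg_neg] using IntervalIntegrable.symm hneg
  rw [truncLine, setIntegral_union hdisj measurableSet_Icc
    (hint.mono_set Set.subset_union_left) (hint.mono_set Set.subset_union_right),
    integral_Icc_eq_integral_Ioc, integral_Icc_eq_integral_Ioc,
    ← intervalIntegral.integral_of_le (by linarith), ← intervalIntegral.integral_of_le hrR.le,
    ← intervalIntegral.integral_comp_neg, add_comm,
    ← intervalIntegral.integral_add hpos hneg']
  simp only [oscillatory_add_neg]
  rw [intervalIntegral.integral_const_mul, intervalIntegral.integral_ofReal,
    sinIntegral_log x y hr hrR]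

theorem norm_setIntegral_oscillatory_le (x y : ℝ) {r R : ℝ} (hr : 0 < r) (hrR : r < R) :
    ‖∫ u in truncLine R r, oscillatory x y u‖ ≤ 4 * Real.pi := by
  rw [setIntegral_oscillatory x y hr hrR, norm_mul, norm_mul, Complex.norm_I, Complex.norm_ofNat,
    Complex.norm_real, Real.norm_eq_abs]
  linarith [abs_sinIntegral_le x y (Real.log r) (Real.log R)]

theorem hasPVIntegral_oscillatory (x y : ℝ) :
    HasPVIntegral (oscillatory x y) (Complex.I * (2 * Real.pi) *
      ((Real.sign x - Real.sign y : ℝ) / 2) * (besselJ0 (2 * Real.sqrt |x * y|) : ℂ)) := by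
  refine ⟨fun R r hr _ => integrableOn_oscillatory x y R hr, ?_⟩
  have hlog : Tendsto (fun p : ℝ × ℝ => (Real.log p.2, Real.log p.1)) (atTop ×ˢ 𝓝[>] (0 : ℝ))
      (atBot ×ˢ atTop) :=
    (Real.tendsto_log_nhdsGT_zero.comp tendsto_snd).prodMk
      (Real.tendsto_log_atTop.comp tendsto_fst)
  have h := (((Complex.continuous_ofReal.tendsto _).comp
    ((tendsto_sinIntegral x y).comp hlog)).const_mul (2 * Complex.I))
  have hval : Complex.I * (2 * Real.pi) * ((Real.sign x - Real.sign y : ℝ) / 2) *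
      (besselJ0 (2 * Real.sqrt |x * y|) : ℂ) =
      2 * Complex.I * ((Real.pi * ((Real.sign x - Real.sign y) / 2) *
        besselJ0 (2 * Real.sqrt |x * y|) : ℝ) : ℂ) := by
    push_cast
    ring
  rw [hval]
  refine h.congr' ?_
  have e1 : ∀ᶠ p : ℝ × ℝ in atTop ×ˢ 𝓝[>] (0 : ℝ), 1 < p.1 :=
    tendsto_fst.eventually (eventually_gt_atTop 1)
  have e2 : ∀ᶠ p : ℝ × ℝ in atTop ×ˢ 𝓝[>] (0 : ℝ), p.2 ∈ Set.Ioo (0 : ℝ) 1 :=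
    tendsto_snd.eventually (Ioo_mem_nhdsGT one_pos)
  filter_upwards [e1, e2] with p h1 h2
  exact (setIntegral_oscillatory x y h2.1 (h2.2.trans h1)).symm

/-- The values `(R, r) = (n + 2, 1 / (n + 2))`. -/
noncomputable def cutoff (n : ℕ) : ℝ × ℝ := ((n : ℝ) + 2, ((n : ℝ) + 2)⁻¹)

theorem cutoff_pos (n : ℕ) : 0 < (cutoff n).2 := by
  unfold cutoff
  positivity

theorem cutoff_lt (n : ℕ) : (cutoff n).2 < (cutoff n).1 := by
  have : (2 : ℝ) ≤ n + 2 := by linarith [n.cast_nonneg (α := ℝ)]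
  exact (inv_lt_one_of_one_lt₀ (by linarith)).trans (by simp only [cutoff]; linarith)

/-- Working along one sequence permits dominated convergence, a.e. convergent subsequences and a
countable union of null sets. -/
theorem tendsto_cutoff : Tendsto cutoff atTop (atTop ×ˢ 𝓝[>] (0 : ℝ)) := by
  have h : Tendsto (fun n : ℕ => (n : ℝ) + 2) atTop atTop :=
    tendsto_atTop_add_const_right _ _ tendsto_natCast_atTop_atTop
  exact h.prodMk (tendsto_inv_atTop_nhdsGT_zero.comp h)

theorem eventually_mem_truncLine {u : ℝ} (hu : u ≠ 0) :
    ∀ᶠ n in atTop, u ∈ truncLine (cutoff n).1 (cutoff n).2 := by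
  have h1 : ∀ᶠ n in atTop, |u| < (cutoff n).1 :=
    (tendsto_fst.comp tendsto_cutoff).eventually (eventually_gt_atTop |u|)
  have h2 : ∀ᶠ n in atTop, (cutoff n).2 ∈ Set.Ioo 0 |u| :=
    (tendsto_snd.comp tendsto_cutoff).eventually (Ioo_mem_nhdsGT (abs_pos.2 hu))
  filter_upwards [h1, h2] with n h1 h2
  rcases hu.lt_or_gt with h | h
  · rw [abs_of_neg h] at h1 h2
    exact Or.inl ⟨by linarith, by linarith [h2.2]⟩
  · rw [abs_of_pos h] at h1 h2
    exact Or.inr ⟨h2.2.le, h1.le⟩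

theorem tendsto_setIntegral_oscillatory (x y : ℝ) :
    Tendsto (fun n => ∫ u in truncLine (cutoff n).1 (cutoff n).2, oscillatory x y u) atTop
      (𝓝 (2 * Real.pi * kernelB x y)) := by
  have hval : 2 * Real.pi * kernelB x y = Complex.I * (2 * Real.pi) *
      ((Real.sign x - Real.sign y : ℝ) / 2) * (besselJ0 (2 * Real.sqrt |x * y|) : ℂ) := by
    rw [kernelB]
    ring
  rw [hval]
  exact (hasPVIntegral_oscillatory x y).2.comp tendsto_cutoff

/-! ### Truncations in `L²(ℝ)` -/

/-- The product of `ψ` with the indicator function of `s`. -/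
noncomputable def restrictL2 (ψ : L2) {s : Set ℝ} (hs : MeasurableSet s) : L2 :=
  ((Lp.memLp ψ).indicator hs).toLp (s.indicator ψ)

theorem coeFn_restrictL2 (ψ : L2) {s : Set ℝ} (hs : MeasurableSet s) :
    restrictL2 ψ hs =ᵐ[volume] s.indicator ψ :=
  MemLp.coeFn_toLp _

/-- Dominated convergence for the squared error, which is `|ψ|²` off `s n` and zero on it. -/
theorem tendsto_restrictL2 (ψ : L2) {s : ℕ → Set ℝ} (hs : ∀ n, MeasurableSet (s n))
    (h : ∀ᵐ u : ℝ, ∀ᶠ n in atTop, u ∈ s n) :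
    Tendsto (fun n => restrictL2 ψ (hs n)) atTop (𝓝 ψ) := by
  rw [Lp.tendsto_Lp_iff_tendsto_eLpNorm']
  have hm := Lp.aestronglyMeasurable ψ
  have e (n : ℕ) : eLpNorm ((restrictL2 ψ (hs n) : ℝ → ℂ) - (ψ : ℝ → ℂ)) 2 volume =
      (∫⁻ u, ‖(s n)ᶜ.indicator ψ u‖ₑ ^ 2) ^ (1 / 2 : ℝ) := by
    rw [eLpNorm_eq_lintegral_rpow_enorm_toReal (by norm_num) (by norm_num)]
    simp only [ENNReal.toReal_ofNat, ENNReal.rpow_ofNat]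
    congr 1
    refine lintegral_congr_ae ?_
    filter_upwards [coeFn_restrictL2 ψ (hs n)] with u hu
    rw [Pi.sub_apply, hu, ← enorm_neg, neg_sub]
    congr 2
    by_cases hus : u ∈ s n <;> simp [hus]
  have hfin : ∫⁻ u, ‖ψ u‖ₑ ^ 2 ≠ ∞ := by
    have := lintegral_rpow_enorm_lt_top_of_eLpNorm_lt_top (p := 2) (by norm_num) (by norm_num)
      (Lp.memLp ψ).2
    simpa using this.ne
  have hlim : Tendsto (fun n => ∫⁻ u, ‖(s n)ᶜ.indicator ψ u‖ₑ ^ 2) atTop (𝓝 (∫⁻ _ : ℝ, 0)) := by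
    refine tendsto_lintegral_of_dominated_convergence' (fun u => ‖ψ u‖ₑ ^ 2)
      (fun n => (hm.indicator (hs n).compl).enorm.pow_const 2)
      (fun n => Eventually.of_forall fun u => ?_) hfin ?_
    · by_cases hus : u ∈ s n <;> simp [hus]
    · filter_upwards [h] with u hu
      refine tendsto_const_nhds.congr' ?_
      filter_upwards [hu] with n hn
      simp [hn]
  simp only [e]
  have := (ENNReal.continuous_rpow_const (y := (1 / 2 : ℝ))).tendsto _ |>.comp hlim
  simpa [Function.comp_def] using this

/-! ### `B` as an integral operator -/

/-- The hypothesis of Fubini: the exponentials have modulus one, and `|u|⁻¹` is integrable away from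
`0` and `∞`. -/
theorem integrable_oscillatory_mul {ψ : ℝ → ℂ} (hψ : Integrable ψ) (x R : ℝ) {r : ℝ}
    (hr : 0 < r) :
    Integrable (fun p : ℝ × ℝ => oscillatory x p.2 p.1 * ψ p.2)
      ((volume.restrict (truncLine R r)).prod volume) := by
  have hinv : IntegrableOn (fun u : ℝ => (u : ℂ)⁻¹) (truncLine R r) := by
    refine ContinuousOn.integrableOn_compact (isCompact_truncLine R r) fun u hu => ?_
    have hu' : (u : ℂ) ≠ 0 := by exact_mod_cast ne_zero_of_mem_truncLine hr hu
    refine ContinuousAt.continuousWithinAt ?_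
    fun_prop (disch := assumption)
  have h := Integrable.bdd_mul (c := 1)
    (f := fun p : ℝ × ℝ => Complex.exp (Complex.I * (x * p.1)) *
      Complex.exp (-(Complex.I * (p.2 / p.1)))) (hinv.mul_prod hψ)
    (Measurable.aestronglyMeasurable (by fun_prop))
    (Eventually.of_forall fun p => by
      rw [norm_mul, Complex.norm_exp, Complex.norm_exp, ← Complex.ofReal_mul,
        ← Complex.ofReal_div]
      simp)
  refine h.congr (Eventually.of_forall fun p => ?_)
  simp only [oscillatory, div_eq_mul_inv]
  ring

/-- The bound on truncations passes to their limit, so no separate estimate of `J₀` is needed. -/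
theorem norm_kernelB_le (x y : ℝ) : ‖2 * Real.pi * kernelB x y‖ ≤ 4 * Real.pi :=
  le_of_tendsto (tendsto_setIntegral_oscillatory x y).norm (Eventually.of_forall fun n =>
    norm_setIntegral_oscillatory_le x y (cutoff_pos n) (cutoff_lt n))

theorem aestronglyMeasurable_setIntegral_oscillatory_mul {ψ : ℝ → ℂ} (hψ : Integrable ψ)
    (x : ℝ) (n : ℕ) : AEStronglyMeasurable (fun y : ℝ =>
      (∫ u in truncLine (cutoff n).1 (cutoff n).2, oscillatory x y u) * ψ y) := by
  have h := (integrable_oscillatory_mul hψ x (cutoff n).1 (cutoff_pos n)).integral_prod_right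
  simp only [integral_mul_const] at h
  exact h.aestronglyMeasurable

theorem integrable_kernelB_mul {ψ : ℝ → ℂ} (hψ : Integrable ψ) (x : ℝ) :
    Integrable fun y : ℝ => kernelB x y * ψ y := by
  have hπ : (2 * Real.pi : ℂ) ≠ 0 := by exact_mod_cast Real.two_pi_pos.ne'
  have h : Integrable fun y : ℝ => 2 * Real.pi * kernelB x y * ψ y := by
    refine (hψ.norm.const_mul (4 * Real.pi)).mono' ?_ (Eventually.of_forall fun y => ?_)
    -- Measurability is likewise inherited from the truncations.
    · exact aestronglyMeasurable_of_tendsto_ae atTop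
        (aestronglyMeasurable_setIntegral_oscillatory_mul hψ x)
        (Eventually.of_forall fun y => (tendsto_setIntegral_oscillatory x y).mul_const _)
    · rw [norm_mul]
      gcongr
      exact norm_kernelB_le x y
  refine (h.const_mul (2 * Real.pi : ℂ)⁻¹).congr (Eventually.of_forall fun y => ?_)
  simp only [mul_assoc _ (kernelB x y)]
  rw [inv_mul_cancel_left₀ hπ]

/-- The uniform bound supplies the dominating function `4π |ψ|`. -/
theorem tendsto_integral_oscillatory_mul {ψ : ℝ → ℂ} (hψ : Integrable ψ) (x : ℝ) :
    Tendsto (fun n => ∫ y, (∫ u in truncLine (cutoff n).1 (cutoff n).2, oscillatory x y u) * ψ y)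
      atTop (𝓝 (∫ y, 2 * Real.pi * kernelB x y * ψ y)) := by
  refine tendsto_integral_of_dominated_convergence (fun y => 4 * Real.pi * ‖ψ y‖)
    (aestronglyMeasurable_setIntegral_oscillatory_mul hψ x) (hψ.norm.const_mul _)
    (fun n => Eventually.of_forall fun y => ?_)
    (Eventually.of_forall fun y => (tendsto_setIntegral_oscillatory x y).mul_const _)
  rw [norm_mul]
  gcongr
  exact norm_setIntegral_oscillatory_le x y (cutoff_pos n) (cutoff_lt n)

theorem inversion_fourier_ae_eq {ψ : L2} (hψ : Integrable ψ) :
    inversion (fourier ψ) =ᵐ[volume] fun u : ℝ => (u : ℂ)⁻¹ *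
      ((Real.sqrt (2 * Real.pi)⁻¹ : ℂ) *
        ∫ y : ℝ, Complex.exp (-(Complex.I * (y / u))) * ψ y) := by
  filter_upwards [coeFn_inversion (fourier ψ),
    isIsoWeight_inversion.quasi.ae (fourier_ae_eq hψ)] with u h1 h2
  rw [h1, h2, one_div]
  congr 3
  ext y
  congr 3
  push_cast
  ring

/-- An `L²` function cut off to a bounded set is integrable, so `F*` is an honest integral here and
Fubini exchanges `u` and `y`. -/
theorem fourier_symm_restrictL2_ae_eq {ψ : L2} (hψ : Integrable ψ) (R : ℝ) {r : ℝ} (hr : 0 < r) :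
    fourier.symm (restrictL2 (inversion (fourier ψ)) (measurableSet_truncLine R r)) =ᵐ[volume]
      fun x : ℝ => (2 * Real.pi : ℂ)⁻¹ *
        ∫ y, (∫ u in truncLine R r, oscillatory x y u) * ψ y := by
  set g := inversion (fourier ψ) with hg
  set c : ℂ := (Real.sqrt (2 * Real.pi)⁻¹ : ℂ) with hc
  have hcc : c * c = (2 * Real.pi : ℂ)⁻¹ := by
    rw [hc, ← Complex.ofReal_mul, Real.mul_self_sqrt (inv_pos.2 Real.two_pi_pos).le]
    push_cast
    rfl
  have hcoe := coeFn_restrictL2 g (measurableSet_truncLine R r)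
  have hint : Integrable (restrictL2 g (measurableSet_truncLine R r)) :=
    (((Lp.memLp g).locallyIntegrable (by norm_num)).integrableOn_isCompact
      (isCompact_truncLine R r)).integrable_indicator (measurableSet_truncLine R r)
      |>.congr hcoe.symm
  filter_upwards [fourier_symm_ae_eq hint] with x hx
  rw [hx]
  have hinner : ∫ u : ℝ, Complex.exp (Complex.I * (x * u)) *
      restrictL2 g (measurableSet_truncLine R r) u =
      ∫ u in truncLine R r, c * ∫ y, oscillatory x y u * ψ y := by
    rw [← integral_indicator (measurableSet_truncLine R r)]
    refine integral_congr_ae ?_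
    filter_upwards [hcoe, inversion_fourier_ae_eq hψ] with u h1 h2
    rw [h1]
    by_cases hu : u ∈ truncLine R r
    · rw [Set.indicator_of_mem hu, Set.indicator_of_mem hu, hg, h2, ← hc, ← integral_const_mul,
        ← integral_const_mul, ← integral_const_mul, ← integral_const_mul]
      refine integral_congr_ae (Eventually.of_forall fun y => ?_)
      simp only [oscillatory, div_eq_mul_inv]
      ring
    · rw [Set.indicator_of_notMem hu, Set.indicator_of_notMem hu, mul_zero]
  rw [hinner, integral_const_mul, ← mul_assoc, hcc,
    integral_integral_swap (integrable_oscillatory_mul hψ x R hr)]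
  simp only [integral_mul_const]

theorem B_ae_eq {ψ : L2} (hψ : Integrable ψ) :
    B ψ =ᵐ[volume] fun x : ℝ => ∫ y : ℝ, kernelB x y * ψ y := by
  have hπ : (2 * Real.pi : ℂ) ≠ 0 := by exact_mod_cast Real.two_pi_pos.ne'
  have hT := tendsto_restrictL2 (inversion (fourier ψ))
    (fun n => measurableSet_truncLine (cutoff n).1 (cutoff n).2)
    ((Measure.ae_ne volume (0 : ℝ)).mono fun u hu => eventually_mem_truncLine hu)
  have hB := (fourier.symm.continuous.tendsto _).comp hT
  -- The `L²` limit `B ψ` is also an a.e. limit along a subsequence, which is compared with the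
  -- pointwise limit of the kernel integrals.
  obtain ⟨ns, hns, hae⟩ := (tendstoInMeasure_of_tendsto_Lp hB).exists_seq_tendsto_ae
  have hn := ae_all_iff.2 fun n =>
    fourier_symm_restrictL2_ae_eq hψ (cutoff n).1 (cutoff_pos n)
  filter_upwards [hae, hn] with x h1 h2
  have h3 := ((tendsto_integral_oscillatory_mul hψ x).comp hns.tendsto_atTop).const_mul
    (2 * Real.pi : ℂ)⁻¹
  refine (tendsto_nhds_unique h1 (h3.congr fun i => (h2 (ns i)).symm)).trans ?_
  simp only [mul_assoc _ (kernelB x _)]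
  rw [integral_const_mul, inv_mul_cancel_left₀ hπ]

/-! ### The shifted operator and density -/

theorem translation_symm_ae_eq (l : ℝ) (ψ : L2) :
    (translation l).symm ψ =ᵐ[volume] fun x : ℝ => ψ (x + 1 / l) := by
  have h := (isIsoWeight_translation (-(1 / l))).quasi.ae
    (coeFn_translation l ((translation l).symm ψ))
  rw [LinearIsometryEquiv.apply_symm_apply] at h
  filter_upwards [h] with x hx
  rw [← sub_neg_eq_add, hx]
  congr 1
  ring

theorem Bshift_ae_eq (l : ℝ) {ψ : L2} (hψ : Integrable ψ) :
    Bshift l ψ =ᵐ[volume] fun x : ℝ => ∫ y : ℝ, kernelB (x + 1 / l) y * ψ y := by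
  filter_upwards [translation_symm_ae_eq l (B ψ),
    (isIsoWeight_translation (-(1 / l))).quasi.ae (B_ae_eq hψ)] with x h1 h2
  rw [sub_neg_eq_add] at h2
  exact h1.trans h2

/-- The set contains the Schwartz functions, which are dense. -/
theorem dense_integrable : Dense {ψ : L2 | Integrable ψ (volume : Measure ℝ)} := by
  refine (SchwartzMap.denseRange_toLpCLM (E := ℝ) (F := ℂ) (p := 2) (μ := volume)
    (by norm_num)).mono ?_
  rintro _ ⟨f, rfl⟩
  exact f.integrable.congr (f.coeFn_toLp 2 volume).symm

end LuttingerB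

theorem lemma3p1 :
    -- `L² ∩ L¹` is dense in `L²`
    Dense {ψ : LuttingerB.L2 | Integrable ψ (volume : Measure ℝ)} ∧
    -- on it, `B` is the integral operator with the kernel
    (∀ ψ : LuttingerB.L2, Integrable ψ (volume : Measure ℝ) →
      (∀ x : ℝ, Integrable (fun y : ℝ => LuttingerB.kernelB x y * ψ y) volume) ∧
      LuttingerB.B ψ =ᵐ[volume] fun x : ℝ => ∫ y : ℝ, LuttingerB.kernelB x y * ψ y) ∧
    -- and `B_l` is the integral operator with the shifted kernel
    (∀ l : ℝ, 0 < l → ∀ ψ : LuttingerB.L2, Integrable ψ (volume : Measure ℝ) →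
      (∀ x : ℝ, Integrable (fun y : ℝ => LuttingerB.kernelB (x + 1 / l) y * ψ y) volume) ∧
      LuttingerB.Bshift l ψ =ᵐ[volume]
        fun x : ℝ => ∫ y : ℝ, LuttingerB.kernelB (x + 1 / l) y * ψ y) ∧
    -- the principal value identity
    (∀ x y : ℝ, LuttingerB.HasPVIntegral (LuttingerB.oscillatory x y)
      (Complex.I * (2 * Real.pi) * ((Real.sign x - Real.sign y : ℝ) / 2) *
        (LuttingerB.besselJ0 (2 * Real.sqrt |x * y|) : ℂ))) ∧
    -- the uniform bound
    (∀ x y R r : ℝ, 0 < r → r < R →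
      ‖∫ u in LuttingerB.truncLine R r, LuttingerB.oscillatory x y u‖ ≤ 4 * Real.pi) := by
  exact ⟨LuttingerB.dense_integrable,
    fun _ hψ => ⟨LuttingerB.integrable_kernelB_mul hψ, LuttingerB.B_ae_eq hψ⟩,
    fun l _ _ hψ => ⟨fun x => LuttingerB.integrable_kernelB_mul hψ (x + 1 / l),
      LuttingerB.Bshift_ae_eq l hψ⟩,
    LuttingerB.hasPVIntegral_oscillatory,
    fun x y _ _ hr hrR => LuttingerB.norm_setIntegral_oscillatory_le x y hr hrR⟩
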